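/- Let $X$ be a standard Borel space and $\mu$ a (not necessarily finite or $\sigma$-finite) measure on its Borel $\sigma$-algebra. A map $f : X \to X$ *preserves the measure class* of $\mu$ if for every Borel set $B \subseteq X$ the image $f(B)$ is $\mu$-measurable (i.e. measurable with respect to the completion of $\mu$), and $\mu(f(B)) = 0$ if and only if $\mu(B) = 0$. Let $G$ be an abstract group with identity $e$. * A *measure class preserving near-action* of $G$ on $(X,\mu)$ is a map $\eta : G \times X \to X$ such that $\eta(e,x) = x$ for $\mu$-almost all $x$; for all $g,h \in G$, $\eta(gh,x) = \eta(g,\eta(h,x))$ for $\mu$-almost all $x$; and for every $g \in G$ the map $\eta(g,\cdot)$ preserves the measure class of $\mu$. * A *measure class preserving spatial action* of $G$ on $(X,\mu)$ is a group action $\rho : G \times X \to X$ in the usual sense such that every $\rho(g,\cdot)$ preserves the measure class of $\mu$. It *acts by Borel automorphisms* if every $\rho(g,\cdot)$ is a Borel bijection of $X$ with Borel inverse. * A *spatial model* of a near-action $\eta$ is a measure class preserving spatial action $\rho$ such that for every $g \in G$, $\eta(g,x) = \rho(g,x)$ for $\mu$-almost all $x$. **Corollary.** Suppose that $\mu$ has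 at least one uncountable null set (this holds, for example, whenever $X$ is uncountable and $\mu$ is $\sigma$-finite; the null set can then be chosen to be Borel). If $G$ is a group of cardinality at most $\aleph_1$, then every measure class preserving near-action of $G$ on $(X,\mu)$ has a spatial model acting by Borel automorphisms. In particular, if the Continuum Hypothesis $2^{\aleph_0} = \aleph_1$ holds, then, for every group $G$ of any cardinality, every measure class preserving near-action of $G$ on $(X,\mu)$ has a spatial model acting by Borel automorphisms. -/

import Mathlib

open MeasureTheory

universe u v

/-- `f` preserves the measure class of `μ`: the image of every Borel set is `μ`-measurable
(measurable for the completion of `μ`), and it is null exactly when the set is null. -/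
def PreservesMeasureClass {X : Type*} [MeasurableSpace X] (μ : Measure X) (f : X → X) : Prop :=
  ∀ B : Set X, MeasurableSet B →
    NullMeasurableSet (f '' B) μ ∧ (μ (f '' B) = 0 ↔ μ B = 0)

/-- `η : G × X → X` (curried) is a measure class preserving near-action of `G` on `(X, μ)`. -/
structure IsNearAction {G X : Type*} [Group G] [MeasurableSpace X] (μ : Measure X)
    (η : G → X → X) : Prop where
  one_ae : ∀ᵐ x ∂μ, η 1 x = x
  mul_ae : ∀ g h : G, ∀ᵐ x ∂μ, η (g * h) x = η g (η h x)
  preserves : ∀ g : G, PreservesMeasureClass μ (η g)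

/-- `ρ : G × X → X` (curried) is a measure class preserving spatial action of `G` on `(X, μ)`:
an action in the usual sense that preserves the measure class. -/
structure IsSpatialAction {G X : Type*} [Group G] [MeasurableSpace X] (μ : Measure X)
    (ρ : G → X → X) : Prop where
  one : ∀ x, ρ 1 x = x
  mul : ∀ (g h : G) (x : X), ρ (g * h) x = ρ g (ρ h x)
  preserves : ∀ g : G, PreservesMeasureClass μ (ρ g)

/-- Every `ρ g` is a Borel automorphism of `X`, a Borel bijection with Borel inverse. -/
def ActsByBorelAutomorphisms {G X : Type*} [MeasurableSpace X] (ρ : G → X → X) : Prop :=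
  ∀ g : G, ∃ e : X ≃ᵐ X, ∀ x, e x = ρ g x

/-- `ρ` is a spatial model of the near-action `η`: a spatial action such that, for each `g`,
`η g` and `ρ g` agree almost everywhere. -/
structure IsSpatialModel {G X : Type*} [Group G] [MeasurableSpace X] (μ : Measure X)
    (η ρ : G → X → X) : Prop where
  isSpatialAction : IsSpatialAction μ ρ
  ae_eq : ∀ g : G, ∀ᵐ x ∂μ, η g x = ρ g x

/-! Well-order `G` so that every proper initial segment is countable, and build a Borel action along
it by extending, again and again, a Borel action of a countable subgroup `H` to a larger countable
subgroup `K`. Borel representatives of `η` on `K`, kept equal to the given action on `H`, satisfy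
the group law on a conull Borel invariant set. Only a null set remains, but there the action of `H`
is already prescribed and need not extend to `K`.

The uncountable null set removes this obstruction. It contains a reservoir of slots, each a copy of
`ℕ → X` on which the groups act by permuting coordinates through a coded action on `ℕ`. A slot that
codes an action of `K` carries an `H`-action extending to `K`, and every Borel `H`-space on `X`
embeds in it equivariantly. Adding the slot to the remaining null set and applying an equivariant
Cantor–Bernstein argument (`exists_extension_of_embeddings`) makes that null set isomorphic, as an
`H`-space, to the slot, so its action extends (`IsPartialModel.exists_extension`). Each step uses up
one slot index, and slots with other indices stay standard, so some are always left; unions of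
chains are harmless.

Under CH, divide by the kernel of the near-action: the quotient has at most continuum many elements,
because a Borel self-map of `X` is determined by countably many Borel sets. -/

/-- The maps `a g`, `g ∈ K`, are Borel and act on the set `A` as the group `K`. -/
structure IsBorelActionOn {G Y : Type*} [Group G] [MeasurableSpace Y] (K : Subgroup G)
    (a : G → Y → Y) (A : Set Y) : Prop where
  measurable : ∀ k ∈ K, Measurable (a k)
  mapsTo : ∀ k ∈ K, Set.MapsTo (a k) A A
  one : ∀ x ∈ A, a 1 x = x
  mul : ∀ k ∈ K, ∀ l ∈ K, ∀ x ∈ A, a (k * l) x = a k (a l x)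

namespace IsBorelActionOn

variable {G Y : Type*} [Group G] [MeasurableSpace Y] {K : Subgroup G} {a b : G → Y → Y}
  {A B : Set Y}

theorem inv_apply (h : IsBorelActionOn K a A) {k : G} (hk : k ∈ K) {x : Y} (hx : x ∈ A) :
    a k⁻¹ (a k x) = x := by
  rw [← h.mul _ (K.inv_mem hk) _ hk x hx, inv_mul_cancel, h.one x hx]

theorem apply_inv (h : IsBorelActionOn K a A) {k : G} (hk : k ∈ K) {x : Y} (hx : x ∈ A) :
    a k (a k⁻¹ x) = x := by
  rw [← h.mul _ hk _ (K.inv_mem hk) x hx, mul_inv_cancel, h.one x hx]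

theorem mem_iff (h : IsBorelActionOn K a Set.univ)
    (hB : ∀ k ∈ K, Set.MapsTo (a k) B B) {k : G} (hk : k ∈ K) {x : Y} : a k x ∈ B ↔ x ∈ B := by
  refine ⟨fun hx => ?_, fun hx => hB k hk hx⟩
  have := hB _ (K.inv_mem hk) hx
  rwa [h.inv_apply hk (Set.mem_univ x)] at this

open Classical in
theorem glue (ha : IsBorelActionOn K a A) (hb : IsBorelActionOn K b B) (hA : MeasurableSet A)
    (hAB : Disjoint A B) :
    IsBorelActionOn K (fun g x => if x ∈ A then a g x else b g x) (A ∪ B) where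
  measurable k hk := Measurable.ite hA (ha.measurable k hk) (hb.measurable k hk)
  mapsTo k hk x hx := by
    by_cases hxA : x ∈ A
    · simpa [hxA] using Or.inl (ha.mapsTo k hk hxA)
    · have hxB := hx.resolve_left hxA
      simpa [hxA] using Or.inr (hb.mapsTo k hk hxB)
  one x hx := by
    by_cases hxA : x ∈ A
    · simpa [hxA] using ha.one x hxA
    · simpa [hxA] using hb.one x (hx.resolve_left hxA)
  mul k hk l hl x hx := by
    by_cases hxA : x ∈ A
    · simp [hxA, ha.mapsTo l hl hxA, ha.mul k hk l hl x hxA]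
    · have hxB := hx.resolve_left hxA
      have : b l x ∉ A := fun h => Set.disjoint_left.1 hAB h (hb.mapsTo l hl hxB)
      simp [hxA, this, hb.mul k hk l hl x hxB]

end IsBorelActionOn

/-! ### Equivariant Cantor–Bernstein -/

/-- The iterates of `g ∘ f` applied to `A \ range g`. -/
def cantorBernsteinSeq {X E : Type*} (f : X → E) (g : E → X) (A : Set X) : ℕ → Set X
  | 0 => A \ Set.range g
  | n + 1 => g '' (f '' cantorBernsteinSeq f g A n)

open Classical in
/-- An equivariant Cantor–Bernstein argument: if the `H`-spaces `A` and `E` embed in each other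
and the action of `H` on `E` extends to `K`, then so does the action on `A`. -/
theorem exists_extension_of_embeddings {G X E : Type*} [Group G] [MeasurableSpace X]
    [MeasurableSpace E] [Nonempty E] [Nonempty X] {H K : Subgroup G}
    {σ : G → X → X} {b : G → E → E} (hσ : IsBorelActionOn H σ Set.univ) (hb : IsBorelActionOn K b Set.univ)
    {f : X → E} (hf : MeasurableEmbedding f) (hfσ : ∀ h ∈ H, ∀ x, f (σ h x) = b h (f x))
    {g : E → X} (hg : MeasurableEmbedding g) (hgb : ∀ h ∈ H, ∀ e, g (b h e) = σ h (g e))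
    {A : Set X} (hA : MeasurableSet A) (hAσ : ∀ h ∈ H, Set.MapsTo (σ h) A A)
    (hgA : ∀ e, g e ∈ A) :
    ∃ a : G → X → X, IsBorelActionOn K a A ∧ ∀ h ∈ H, ∀ x ∈ A, a h x = σ h x := by
  obtain ⟨g', hg', hgg'⟩ := hg.exists_measurable_extend measurable_id (fun _ => inferInstance)
  obtain ⟨f', hf', hff'⟩ := hf.exists_measurable_extend measurable_id (fun _ => inferInstance)
  replace hgg' : ∀ e, g' (g e) = e := congrFun hgg'
  replace hff' : ∀ x, f' (f x) = x := congrFun hff'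
  set s := cantorBernsteinSeq f g A
  have s_meas : ∀ n, MeasurableSet (s n) := by
    intro n
    induction n with
    | zero => exact hA.diff hg.measurableSet_range
    | succ n ih => exact hg.measurableSet_image.2 (hf.measurableSet_image.2 ih)
  have s_inv : ∀ n, ∀ h ∈ H, Set.MapsTo (σ h) (s n) (s n) := by
    intro n
    induction n with
    | zero =>
      rintro h hh x ⟨hxA, hx⟩
      refine ⟨hAσ h hh hxA, ?_⟩
      rintro ⟨e, he⟩
      refine hx ⟨b h⁻¹ e, ?_⟩
      rw [hgb _ (H.inv_mem hh), he, hσ.inv_apply hh (Set.mem_univ x)]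
    | succ n ih =>
      rintro h hh _ ⟨_, ⟨x, hx, rfl⟩, rfl⟩
      exact ⟨_, ⟨σ h x, ih h hh hx, rfl⟩, by rw [hfσ h hh, hgb h hh]⟩
  set S : Set X := ⋃ n, s n
  have S_meas : MeasurableSet S := MeasurableSet.iUnion s_meas
  have S_inv : ∀ h ∈ H, Set.MapsTo (σ h) S S := by
    intro h hh x hx
    obtain ⟨n, hn⟩ := Set.mem_iUnion.1 hx
    exact Set.mem_iUnion.2 ⟨n, s_inv n h hh hn⟩
  have range_of_notMem : ∀ x ∈ A, x ∉ S → ∃ e, g e = x := by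
    intro x hxA hxS
    by_contra hx
    exact hxS (Set.mem_iUnion.2 ⟨0, hxA, hx⟩)
  have g_mem : ∀ e, g e ∈ S ↔ e ∈ f '' S := by
    intro e
    constructor
    · intro he
      obtain ⟨n, hn⟩ := Set.mem_iUnion.1 he
      cases n with
      | zero => exact absurd ⟨e, rfl⟩ hn.2
      | succ n =>
        obtain ⟨_, ⟨x, hx, rfl⟩, h⟩ := hn
        exact ⟨x, Set.mem_iUnion.2 ⟨n, hx⟩, hg.injective h⟩
    · rintro ⟨x, hx, rfl⟩
      obtain ⟨n, hn⟩ := Set.mem_iUnion.1 hx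
      exact Set.mem_iUnion.2 ⟨n + 1, _, ⟨x, hn, rfl⟩, rfl⟩
  have S_subset : S ⊆ A := by
    intro x hx
    obtain ⟨n, hn⟩ := Set.mem_iUnion.1 hx
    cases n with
    | zero => exact hn.1
    | succ n =>
      obtain ⟨_, _, rfl⟩ := hn
      exact hgA _
  -- The Cantor–Bernstein bijection from `A` to `E`: `f` on `S` and the inverse of `g` off it. As
  -- `S` is `H`-invariant, it is `H`-equivariant, and the action of `K` is pulled back along it.
  let ψ : X → E := fun x => if x ∈ S then f x else g' x
  let θ : E → X := fun e => if e ∈ f '' S then f' e else g e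
  have ψ_meas : Measurable ψ := Measurable.ite S_meas hf.measurable hg'
  have θ_meas : Measurable θ :=
    Measurable.ite (hf.measurableSet_image.2 S_meas) hf' hg.measurable
  have θψ : ∀ x ∈ A, θ (ψ x) = x := by
    intro x hxA
    by_cases hx : x ∈ S
    · have : f x ∈ f '' S := ⟨x, hx, rfl⟩
      simp only [ψ, θ, if_pos hx, if_pos this, hff']
    · obtain ⟨e, rfl⟩ := range_of_notMem x hxA hx
      have : e ∉ f '' S := fun h => hx ((g_mem e).2 h)
      simp only [ψ, θ, if_neg hx, hgg', if_neg this]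
  have ψθ : ∀ e, ψ (θ e) = e := by
    intro e
    by_cases he : e ∈ f '' S
    · obtain ⟨x, hx, rfl⟩ := id he
      simp only [ψ, θ, if_pos he, hff', if_pos hx]
    · have : g e ∉ S := fun h => he ((g_mem e).1 h)
      simp only [ψ, θ, if_neg he, if_neg this, hgg']
  have θA : ∀ e, θ e ∈ A := by
    intro e
    by_cases he : e ∈ f '' S
    · obtain ⟨x, hx, rfl⟩ := id he
      simpa only [θ, if_pos he, hff'] using S_subset hx
    · simpa only [θ, if_neg he] using hgA e
  have ψσ : ∀ h ∈ H, ∀ x ∈ A, ψ (σ h x) = b h (ψ x) := by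
    intro h hh x hxA
    by_cases hx : x ∈ S
    · simp only [ψ, if_pos hx, if_pos (S_inv h hh hx), hfσ h hh]
    · have hx' : σ h x ∉ S := fun h' => hx ((hσ.mem_iff S_inv hh).1 h')
      obtain ⟨e, rfl⟩ := range_of_notMem x hxA hx
      simp only [ψ, if_neg hx, if_neg hx']
      rw [← hgb h hh, hgg', hgg']
  refine ⟨fun k x => θ (b k (ψ x)), ⟨?_, ?_, ?_, ?_⟩, ?_⟩
  · exact fun k hk => θ_meas.comp ((hb.measurable k hk).comp ψ_meas)
  · exact fun k _ x _ => θA _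
  · intro x hx
    rw [hb.one _ (Set.mem_univ _), θψ x hx]
  · intro k hk l hl x _
    rw [ψθ, hb.mul k hk l hl _ (Set.mem_univ _)]
  · intro h hh x hx
    change θ (b h (ψ x)) = σ h x
    rw [← ψσ h hh x hx, θψ _ (hAσ h hh hx)]

/-! ### Near-actions and null sets -/

theorem PreservesMeasureClass.measure_image_eq_zero {X : Type*} [MeasurableSpace X]
    {μ : Measure X} {f : X → X} (hf : PreservesMeasureClass μ f) {N : Set X} (hN : μ N = 0) :
    μ (f '' N) = 0 :=
  measure_mono_null (Set.image_mono (subset_toMeasurable μ N))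
    ((hf _ (measurableSet_toMeasurable μ N)).2.2 (by rwa [measure_toMeasurable]))

namespace IsNearAction

variable {G X : Type*} [Group G] [MeasurableSpace X] {μ : Measure X} {η : G → X → X}

theorem inv_apply_ae (hη : IsNearAction μ η) (g : G) : ∀ᵐ x ∂μ, η g⁻¹ (η g x) = x := by
  filter_upwards [hη.mul_ae g⁻¹ g, hη.one_ae] with x h₁ h₂
  rw [← h₁, inv_mul_cancel, h₂]

/-- Almost everywhere `η g⁻¹` inverts `η g`; the exceptional set on the other side is null, and so
is its image under `η g⁻¹`. This turns the hypothesis on images into information on preimages. -/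
theorem preimage_ae_eq_image_inv (hη : IsNearAction μ η) (g : G) (B : Set X) :
    η g ⁻¹' B =ᵐ[μ] η g⁻¹ '' B := by
  have h₁ := hη.inv_apply_ae g
  have h₂ : μ {x | ¬ η g (η g⁻¹ x) = x} = 0 := by
    have := hη.inv_apply_ae g⁻¹
    rwa [inv_inv] at this
  have h₃ := (hη.preserves g⁻¹).measure_image_eq_zero h₂
  have h₄ : ∀ᵐ x ∂μ, x ∉ η g⁻¹ '' {x | ¬ η g (η g⁻¹ x) = x} := measure_eq_zero_iff_ae_notMem.1 h₃
  filter_upwards [h₁, h₄] with x hx hx'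
  refine propext ⟨fun h => ⟨η g x, h, hx⟩, ?_⟩
  rintro ⟨b, hb, rfl⟩
  have : η g (η g⁻¹ b) = b := by
    by_contra hne
    exact hx' ⟨b, hne, rfl⟩
  change η g (η g⁻¹ b) ∈ B
  rwa [this]

theorem measure_preimage_eq_zero (hη : IsNearAction μ η) (g : G) {N : Set X} (hN : μ N = 0) :
    μ (η g ⁻¹' N) = 0 := by
  rw [measure_congr (hη.preimage_ae_eq_image_inv g N)]
  exact (hη.preserves g⁻¹).measure_image_eq_zero hN

/-- Preimages of Borel sets are null-measurable, being a.e. equal to images under `η g⁻¹`. Since `X`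
is countably generated, this yields a Borel representative with no finiteness assumption on `μ`. -/
theorem aemeasurable [StandardBorelSpace X] (hη : IsNearAction μ η) (g : G) :
    AEMeasurable (η g) μ := by
  have : NullMeasurable (η g) μ := fun B hB =>
    ((hη.preserves g⁻¹ B hB).1).congr (hη.preimage_ae_eq_image_inv g B).symm
  exact this.aemeasurable

theorem ae_comp (hη : IsNearAction μ η) (g : G) {p : X → Prop} (hp : ∀ᵐ x ∂μ, p x) :
    ∀ᵐ x ∂μ, p (η g x) :=
  hη.measure_preimage_eq_zero g hp

end IsNearAction

/-- A Borel action that agrees almost everywhere with a near-action is a spatial model of it. -/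
theorem isSpatialModel_of_isBorelActionOn {G X : Type*} [Group G] [MeasurableSpace X]
    {μ : Measure X} {η ρ : G → X → X} (hη : IsNearAction μ η)
    (hρ : IsBorelActionOn (⊤ : Subgroup G) ρ Set.univ) (h : ∀ g, ∀ᵐ x ∂μ, η g x = ρ g x) :
    IsSpatialModel μ η ρ ∧ ActsByBorelAutomorphisms ρ := by
  have left : ∀ g x, ρ g⁻¹ (ρ g x) = x := fun g x => hρ.inv_apply trivial trivial
  have right : ∀ g x, ρ g (ρ g⁻¹ x) = x := fun g x => hρ.apply_inv trivial trivial
  have image_eq : ∀ g B, ρ g '' B = ρ g⁻¹ ⁻¹' B := fun g =>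
    congrFun (Set.image_eq_preimage_of_inverse (left g) (right g))
  have null : ∀ g B, μ B = 0 → μ (ρ g ⁻¹' B) = 0 := by
    intro g B hB
    have : ρ g ⁻¹' B =ᵐ[μ] η g ⁻¹' B := by
      filter_upwards [h g] with x hx
      change (ρ g x ∈ B) = (η g x ∈ B)
      rw [hx]
    rw [measure_congr this]
    exact hη.measure_preimage_eq_zero g hB
  refine ⟨⟨⟨fun x => hρ.one x trivial, fun g h x => hρ.mul g trivial h trivial x trivial, ?_⟩, h⟩,
    ?_⟩
  · intro g B hB
    rw [image_eq]
    refine ⟨(hρ.measurable g⁻¹ trivial hB).nullMeasurableSet, fun h0 => ?_, null _ _⟩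
    have := null g _ h0
    rwa [← Set.preimage_comp, show ρ g⁻¹ ∘ ρ g = id from funext (left g)] at this
  · exact fun g => ⟨⟨⟨ρ g, ρ g⁻¹, left g, right g⟩, hρ.measurable g trivial,
      hρ.measurable g⁻¹ trivial⟩, fun x => rfl⟩

/-! ### The reservoir of coded actions -/

/-- A parameter coding a map `ℕ → ℕ` for each point of `X`. -/
abbrev PermCode (X : Type*) := (ℕ → X) × (ℕ → ℕ → ℕ)

/-- Pieces of a reservoir, indexed by `X` and by codes, each of them a copy of `ℕ → X`. -/
abbrev Slot (X : Type*) := X × PermCode X × (ℕ → X)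

section Slot

variable {G X : Type*} [Group G] (e : G → X)

/-- The map of `ℕ` that the code `r` attaches to `g`. -/
noncomputable def PermCode.toMap (r : PermCode X) (g : G) : ℕ → ℕ :=
  r.2 (sInf {n | r.1 n = e g})

/-- The codes for which `PermCode.toMap` is an action of `H` on `ℕ`. -/
def PermCode.actionSet (H : Subgroup G) : Set (PermCode X) :=
  {r | r.toMap e 1 = id ∧ ∀ h ∈ H, ∀ k ∈ H, r.toMap e (h * k) = r.toMap e h ∘ r.toMap e k}

/-- The shift of the last coordinate of a slot by the coded map. -/
noncomputable def Slot.act (g : G) (s : Slot X) : Slot X :=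
  (s.1, s.2.1, s.2.2 ∘ s.2.1.toMap e g⁻¹)

/-- The slots with index outside `C` on which `H` acts. -/
def Slot.actionSet (H : Subgroup G) (C : Set X) : Set (Slot X) :=
  {s | s.1 ∉ C ∧ s.2.1 ∈ PermCode.actionSet e H}

theorem PermCode.actionSet_anti {H K : Subgroup G} (h : H ≤ K) :
    PermCode.actionSet e K ⊆ PermCode.actionSet e H :=
  fun _ hr => ⟨hr.1, fun a ha b hb => hr.2 a (h ha) b (h hb)⟩

theorem Slot.actionSet_anti {H K : Subgroup G} (h : H ≤ K) {C D : Set X} (hCD : C ⊆ D) :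
    Slot.actionSet e K D ⊆ Slot.actionSet e H C :=
  fun _ hs => ⟨fun h' => hs.1 (hCD h'), PermCode.actionSet_anti e h hs.2⟩

/-- Some code describes an action of the countable group `K` on `ℕ` with an equivariant map to
the left translation action of `K`. -/
theorem PermCode.exists_mem_actionSet {e : G → X} (he : Function.Injective e) (K : Subgroup G)
    [Countable K] :
    ∃ r ∈ PermCode.actionSet e K, ∃ q : ℕ → G,
      ∀ k ∈ K, ∀ n, q (r.toMap e k n) = k * q n := by
  obtain ⟨s, hs⟩ := exists_surjective_nat K
  -- The factor `ℕ` makes the set infinite even when `K` is finite; `K` translates the first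
  -- coordinate, which is the equivariant map `q`.
  obtain ⟨φ⟩ : Nonempty (ℕ ≃ K × ℕ) := nonempty_equiv_of_countable
  let r : PermCode X := (fun n => e (s n), fun n m => φ.symm (s n * (φ m).1, (φ m).2))
  have hr : ∀ k : K, r.toMap e k = fun m => φ.symm (k * (φ m).1, (φ m).2) := by
    intro k
    obtain ⟨n, hn⟩ := hs k
    have hmem : sInf {n | r.1 n = e k} ∈ {n | r.1 n = e k} :=
      Nat.sInf_mem ⟨n, by simp [r, hn]⟩
    have : s (sInf {n | r.1 n = e k}) = k := Subtype.ext (he hmem)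
    simp only [PermCode.toMap, r] at this ⊢
    rw [this]
  refine ⟨r, ⟨?_, ?_⟩, fun n => (φ n).1, ?_⟩
  · have := hr 1
    rw [OneMemClass.coe_one] at this
    rw [this]
    ext m
    simp
  · intro h hh k hk
    have h₁ := hr ⟨h, hh⟩
    have h₂ := hr ⟨k, hk⟩
    have h₃ := hr (⟨h, hh⟩ * ⟨k, hk⟩)
    simp only [Subgroup.coe_mul] at h₁ h₂ h₃
    rw [h₁, h₂, h₃]
    ext m
    simp [← mul_assoc]
  · intro k hk n
    rw [hr ⟨k, hk⟩]
    simp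

variable [MeasurableSpace X] [StandardBorelSpace X]

theorem PermCode.measurable_toMap {G : Type*} (e : G → X) (g : G) :
    Measurable fun r : PermCode X => r.toMap e g := by
  classical
  have hset : ∀ n, MeasurableSet {r : PermCode X | r.1 n = e g} := fun n =>
    measurableSet_eq_fun ((measurable_pi_apply n).comp measurable_fst) measurable_const
  have hcode : Measurable fun r : PermCode X => sInf {n | r.1 n = e g} := by
    refine measurable_to_countable' fun n => ?_
    -- The second piece accounts for `sInf ∅ = 0`, when the code does not mention `e g`.
    have : (fun r : PermCode X => sInf {n | r.1 n = e g}) ⁻¹' {n} =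
        ({r | r.1 n = e g} ∩ ⋂ m ∈ Set.Iio n, {r | r.1 m = e g}ᶜ) ∪
          ({_r | n = 0} ∩ ⋂ m, {r | r.1 m = e g}ᶜ) := by
      ext r
      change sInf {n | r.1 n = e g} = n ↔ _
      simp only [Set.mem_union, Set.mem_inter_iff, Set.mem_iInter, Set.mem_compl_iff, Set.mem_Iio,
        Set.mem_ofPred_eq]
      constructor
      · rintro rfl
        by_cases h : {n | r.1 n = e g}.Nonempty
        · exact Or.inl ⟨Nat.sInf_mem h, fun m hm => Nat.notMem_of_lt_sInf hm⟩
        · rw [Set.not_nonempty_iff_eq_empty] at h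
          refine Or.inr ⟨by rw [h, Nat.sInf_empty], fun m hm => ?_⟩
          have : m ∈ {n | r.1 n = e g} := hm
          simp [h] at this
      · rintro (⟨h₁, h₂⟩ | ⟨rfl, h⟩)
        · refine le_antisymm (Nat.sInf_le h₁) (le_of_not_gt fun hlt => ?_)
          exact h₂ _ hlt (Nat.sInf_mem (s := {n | r.1 n = e g}) ⟨n, h₁⟩)
        · simp [h]
    rw [this]
    exact ((hset n).inter (MeasurableSet.biInter (Set.to_countable _) fun m _ =>
      (hset m).compl)).union
        ((MeasurableSet.const _).inter (MeasurableSet.iInter fun m => (hset m).compl))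
  have heval : Measurable fun q : (ℕ → ℕ → ℕ) × ℕ => q.1 q.2 :=
    measurable_from_prod_countable_left fun n => measurable_pi_apply n
  exact heval.comp (measurable_snd.prodMk hcode)

/-- Countability of `H` leaves only countably many Borel conditions. This is why every subgroup
being extended to must be countable. -/
theorem PermCode.measurableSet_actionSet (H : Subgroup G) [Countable H] :
    MeasurableSet (PermCode.actionSet e H) := by
  have hm := PermCode.measurable_toMap (X := X) e
  have hcomp : ∀ h k : G, Measurable fun r : PermCode X => r.toMap e h ∘ r.toMap e k := by
    intro h k
    have heval : Measurable fun q : (ℕ → ℕ) × ℕ => q.1 q.2 :=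
      measurable_from_prod_countable_left fun n => measurable_pi_apply n
    exact measurable_pi_lambda _ fun n =>
      heval.comp ((hm h).prodMk ((measurable_pi_apply n).comp (hm k)))
  have : PermCode.actionSet e H = {r : PermCode X | r.toMap e 1 = id} ∩
      ⋂ (h : H) (k : H), {r | r.toMap e (h * k : G) = r.toMap e h ∘ r.toMap e k} := by
    ext r
    simp [PermCode.actionSet]
  rw [this]
  exact (measurableSet_eq_fun (hm 1) measurable_const).inter (MeasurableSet.iInter fun h =>
    MeasurableSet.iInter fun k => measurableSet_eq_fun (hm _) (hcomp _ _))

theorem Slot.measurableSet_actionSet (H : Subgroup G) [Countable H] {C : Set X}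
    (hC : C.Countable) : MeasurableSet (Slot.actionSet e H C) :=
  (measurable_fst hC.measurableSet.compl).inter
    (measurable_fst.comp measurable_snd (PermCode.measurableSet_actionSet e H))

theorem Slot.measurable_act (g : G) : Measurable (Slot.act (X := X) e g) := by
  have heval : Measurable fun q : (ℕ → X) × ℕ => q.1 q.2 :=
    measurable_from_prod_countable_left fun n => measurable_pi_apply n
  refine measurable_fst.prodMk ((measurable_fst.comp measurable_snd).prodMk ?_)
  exact measurable_pi_lambda _ fun n => heval.comp <|
    (measurable_snd.comp measurable_snd).prodMk <| (measurable_pi_apply n).comp <|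
      (PermCode.measurable_toMap e g⁻¹).comp (measurable_fst.comp measurable_snd)

theorem Slot.isBorelActionOn_actionSet (H : Subgroup G) (C : Set X) :
    IsBorelActionOn H (Slot.act e) (Slot.actionSet e H C) where
  measurable k _ := Slot.measurable_act e k
  mapsTo _ _ _ hs := hs
  one s hs := by simp [Slot.act, hs.2.1]
  mul k hk l hl s hs := by
    simp [Slot.act, hs.2.2 _ (H.inv_mem hl) _ (H.inv_mem hk), Function.comp_assoc]

end Slot

/-- Fix a representative of each coset `Hg` and let `c g` be the element of `H` carrying it to `g`.
-/
theorem Subgroup.exists_left_equivariant_map {G : Type*} [Group G] (H : Subgroup G) :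
    ∃ c : G → G, (∀ g, c g ∈ H) ∧ ∀ h ∈ H, ∀ g, c (h * g) = h * c g := by
  refine ⟨fun g => g * (Quotient.out (Quotient.mk (QuotientGroup.rightRel H) g))⁻¹, ?_, ?_⟩
  · intro g
    exact QuotientGroup.rightRel_apply.1 (Quotient.mk_out (s := QuotientGroup.rightRel H) g)
  · intro h hh g
    have : Quotient.mk (QuotientGroup.rightRel H) (h * g) =
        Quotient.mk (QuotientGroup.rightRel H) g := by
      refine Quotient.sound (QuotientGroup.rightRel_apply.2 ?_)
      simpa using H.inv_mem hh
    simp only [this, mul_assoc]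

/-! ### Extending a partial model to a larger countable group -/

/-- `σ` is a Borel action of `H` that agrees almost everywhere with `η` and is the standard action
on the slots embedded by `ι` whose index is outside `C`. -/
structure IsPartialModel {G X : Type*} [Group G] [MeasurableSpace X] (μ : Measure X)
    (η : G → X → X) (e : G → X) (ι : Slot X → X) (H : Subgroup G) (C : Set X)
    (σ : G → X → X) : Prop where
  action : IsBorelActionOn H σ Set.univ
  ae_eq : ∀ h ∈ H, ∀ᵐ x ∂μ, η h x = σ h x
  slot : ∀ h ∈ H, ∀ s ∈ Slot.actionSet e H C, σ h (ι s) = ι (Slot.act e h s)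

section Extension

variable {G X : Type*} [Group G] [MeasurableSpace X] [StandardBorelSpace X] {μ : Measure X}
  {η : G → X → X}

/-- Borel representatives of a near-action of a countable group act on some conull Borel set
that avoids a given null set. -/
theorem IsNearAction.exists_conull_action (hη : IsNearAction μ η) {K : Subgroup G} [Countable K]
    {F : G → X → X} (hF : ∀ k ∈ K, Measurable (F k)) (hFη : ∀ k ∈ K, ∀ᵐ x ∂μ, η k x = F k x)
    {N : Set X} (hN : MeasurableSet N) (hμN : μ N = 0) :
    ∃ X₀ : Set X, MeasurableSet X₀ ∧ (∀ᵐ x ∂μ, x ∈ X₀) ∧ Disjoint X₀ N ∧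
      IsBorelActionOn K F X₀ := by
  let A : Set X := {x | F 1 x = x} ∩
    ⋂ (k : K) (l : K), {x | F (k * l : G) x = F k (F l x)}
  have hF1 : Measurable (F 1) := hF 1 K.one_mem
  have hA : MeasurableSet A :=
    (measurableSet_eq_fun hF1 measurable_id).inter <|
      MeasurableSet.iInter fun k => MeasurableSet.iInter fun l =>
        measurableSet_eq_fun (hF _ (K.mul_mem k.2 l.2)) ((hF k k.2).comp (hF l l.2))
  have mem_A : ∀ x, x ∈ A ↔ F 1 x = x ∧ ∀ k ∈ K, ∀ l ∈ K, F (k * l) x = F k (F l x) := by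
    intro x
    simp [A]
  have ae_A : ∀ᵐ x ∂μ, x ∈ A := by
    have h : ∀ᵐ x ∂μ, ∀ k l : K, F (k * l : G) x = F k (F l x) := by
      refine ae_all_iff.2 fun k => ae_all_iff.2 fun l => ?_
      filter_upwards [hη.mul_ae k l, hFη l l.2, hFη _ (K.mul_mem k.2 l.2),
        hη.ae_comp l (hFη k k.2)] with x h₁ h₂ h₃ h₄
      rw [← h₃, ← h₂, ← h₄, h₁]
    filter_upwards [h, hη.one_ae, hFη 1 K.one_mem] with x h₁ h₂ h₃
    exact (mem_A x).2 ⟨h₃ ▸ h₂, fun k hk l hl => h₁ ⟨k, hk⟩ ⟨l, hl⟩⟩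
  have ae_N : ∀ᵐ x ∂μ, x ∉ N := measure_eq_zero_iff_ae_notMem.1 hμN
  -- The points of `A` whose whole orbit stays in `A` and off `N`; the group law on `A` makes this
  -- set invariant.
  let X₀ : Set X := A ∩ ⋂ k : K, F k ⁻¹' (A ∩ Nᶜ)
  have mem_X₀ : ∀ x, x ∈ X₀ ↔ x ∈ A ∧ ∀ k ∈ K, F k x ∈ A ∧ F k x ∉ N := by
    intro x
    simp [X₀]
  refine ⟨X₀, ?_, ?_, ?_, hF, ?_, ?_, ?_⟩
  · exact hA.inter (MeasurableSet.iInter fun k => hF k k.2 (hA.inter hN.compl))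
  · have h : ∀ᵐ x ∂μ, ∀ k : K, F k x ∈ A ∧ F k x ∉ N := by
      refine ae_all_iff.2 fun k => ?_
      filter_upwards [hFη k k.2, hη.ae_comp k ae_A, hη.ae_comp k ae_N] with x h₁ h₂ h₃
      exact h₁ ▸ ⟨h₂, h₃⟩
    filter_upwards [h, ae_A] with x h₁ h₂
    exact (mem_X₀ x).2 ⟨h₂, fun k hk => h₁ ⟨k, hk⟩⟩
  · refine Set.disjoint_left.2 fun x hx hxN => ?_
    obtain ⟨h₁, h₂⟩ := (mem_X₀ x).1 hx
    have := (h₂ 1 K.one_mem).2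
    rw [((mem_A x).1 h₁).1] at this
    exact this hxN
  · intro k hk x hx
    obtain ⟨h₁, h₂⟩ := (mem_X₀ x).1 hx
    refine (mem_X₀ _).2 ⟨(h₂ k hk).1, fun l hl => ?_⟩
    rw [← ((mem_A x).1 h₁).2 l hl k hk]
    exact h₂ _ (K.mul_mem hl hk)
  · exact fun x hx => ((mem_A x).1 ((mem_X₀ x).1 hx).1).1
  · exact fun k hk l hl x hx => ((mem_A x).1 ((mem_X₀ x).1 hx).1).2 k hk l hl

-- The space splits into a conull set where representatives of `η` act, the slots that remain
-- reserved, and a null remainder. The remainder contains the slot with index `t` and a code for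
-- `K`, whose `H`-action extends to `K`; Cantor–Bernstein spreads this to the whole remainder.
open Classical in
theorem IsPartialModel.exists_extension [Nonempty X] (hη : IsNearAction μ η) {e : G → X}
    (he : Function.Injective e) {ι : Slot X → X} (hι : MeasurableEmbedding ι)
    (hιμ : μ (Set.range ι) = 0) {H K : Subgroup G} (hHK : H ≤ K) [Countable K] {C : Set X}
    (hC : C.Countable) {t : X} (ht : t ∉ C) {σ : G → X → X}
    (hσ : IsPartialModel μ η e ι H C σ) :
    ∃ σ' : G → X → X, IsPartialModel μ η e ι K (insert t C) σ' ∧ ∀ h ∈ H, σ' h = σ h := by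
  have hH := hσ.action
  -- Retaining `σ` on `H` makes the result an extension of `σ`, not just a.e. equal to it, and makes
  -- `X₀` invariant under `σ`.
  let F : G → X → X := fun k => if k ∈ H then σ k else (hη.aemeasurable k).mk (η k)
  have F_of_mem : ∀ h ∈ H, F h = σ h := fun h hh => if_pos hh
  have F_meas : ∀ k, Measurable (F k) := by
    intro k
    by_cases hk : k ∈ H
    · simpa only [F, if_pos hk] using hH.measurable k hk
    · simpa only [F, if_neg hk] using (hη.aemeasurable k).measurable_mk
  have F_ae : ∀ k, ∀ᵐ x ∂μ, η k x = F k x := by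
    intro k
    by_cases hk : k ∈ H
    · simpa only [F, if_pos hk] using hσ.ae_eq k hk
    · simp only [F, if_neg hk]
      exact (hη.aemeasurable k).ae_eq_mk
  obtain ⟨X₀, X₀_meas, X₀_ae, X₀_disj, hF⟩ := hη.exists_conull_action (K := K)
    (fun k _ => F_meas k) (fun k _ => F_ae k) hι.measurableSet_range hιμ
  -- the action on the slots that are kept
  obtain ⟨κ, hκ, hκι⟩ := hι.exists_measurable_extend (measurable_id (α := Slot X))
    (fun _ => inferInstance)
  replace hκι : ∀ s, κ (ι s) = s := congrFun hκι
  set T := Slot.actionSet e K (insert t C)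
  have T_meas : MeasurableSet T := Slot.measurableSet_actionSet e K (hC.insert t)
  have hact := Slot.isBorelActionOn_actionSet e K (insert t C)
  have T_sub : T ⊆ Slot.actionSet e H C := Slot.actionSet_anti e hHK (Set.subset_insert t C)
  have hS : IsBorelActionOn K (fun k x => ι (Slot.act e k (κ x))) (ι '' T) := by
    refine ⟨fun k hk => hι.measurable.comp ((hact.measurable k hk).comp hκ), ?_, ?_, ?_⟩
    · rintro k hk _ ⟨s, hs, rfl⟩
      exact ⟨_, hact.mapsTo k hk hs, by simp only [hκι]⟩
    · rintro _ ⟨s, hs, rfl⟩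
      rw [hκι, hact.one s hs]
    · rintro k hk l hl _ ⟨s, hs, rfl⟩
      simp only [hκι, hact.mul k hk l hl s hs]
  have X₀_disj' : Disjoint X₀ (ι '' T) := X₀_disj.mono_right (Set.image_subset_range ι T)
  have hU := hF.glue hS X₀_meas X₀_disj'
  have U_meas : MeasurableSet (X₀ ∪ ι '' T) := X₀_meas.union (hι.measurableSet_image.2 T_meas)
  have hUσ : ∀ h ∈ H, Set.MapsTo (σ h) (X₀ ∪ ι '' T) (X₀ ∪ ι '' T) := by
    rintro h hh x (hx | ⟨s, hs, rfl⟩)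
    · rw [← F_of_mem h hh]
      exact Or.inl (hF.mapsTo h (hHK hh) hx)
    · rw [hσ.slot h hh s (T_sub hs)]
      exact Or.inr ⟨_, hact.mapsTo h (hHK hh) hs, rfl⟩
  -- the action on the remaining null set
  obtain ⟨r, hr, q, hq⟩ := PermCode.exists_mem_actionSet he K
  obtain ⟨c, hcH, hc⟩ := H.exists_left_equivariant_map
  let b : G → (ℕ → X) → (ℕ → X) := fun k z => z ∘ r.toMap e k⁻¹
  have hb : IsBorelActionOn K b Set.univ := by
    refine ⟨fun k _ => measurable_pi_lambda _ fun n => measurable_pi_apply _,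
      fun k _ z _ => trivial, fun z _ => ?_, fun k hk l hl z _ => ?_⟩
    · simp [b, hr.1]
    · simp only [b, mul_inv_rev, hr.2 _ (K.inv_mem hl) _ (K.inv_mem hk), Function.comp_assoc]
  -- The map `c ∘ q : ℕ → H` is `H`-equivariant, so listing the translates of `x` by the inverses of
  -- its values turns `σ h` into the coordinate shift `b h`. Any one coordinate recovers `x`.
  let f : X → ℕ → X := fun x n => σ (c (q n))⁻¹ x
  have hf : MeasurableEmbedding f := by
    refine Measurable.measurableEmbedding
      (measurable_pi_lambda _ fun n => hH.measurable _ (H.inv_mem (hcH _))) fun x y hxy => ?_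
    have h₁ : σ (c (q 0))⁻¹ x = σ (c (q 0))⁻¹ y := congrFun hxy 0
    rw [← hH.apply_inv (hcH (q 0)) (Set.mem_univ x), h₁,
      hH.apply_inv (hcH (q 0)) (Set.mem_univ y)]
  have hfσ : ∀ h ∈ H, ∀ x, f (σ h x) = b h (f x) := by
    intro h hh x
    funext n
    simp only [f, b, Function.comp_apply]
    rw [hq _ (K.inv_mem (hHK hh)), hc _ (H.inv_mem hh),
      ← hH.mul _ (H.inv_mem (hcH _)) _ hh x trivial, mul_inv_rev, inv_inv]
  -- The slot spent at this step. Its index `t` is outside `C`, so `σ` is standard on it, but it is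
  -- excluded from `T`, so it lies in the remainder.
  let g : (ℕ → X) → X := fun z => ι (t, r, z)
  have hg : MeasurableEmbedding g := by
    refine Measurable.measurableEmbedding
      (hι.measurable.comp (measurable_const.prodMk (measurable_const.prodMk measurable_id)))
      fun z w hzw => ?_
    have := hι.injective hzw
    simpa using this
  have hgb : ∀ h ∈ H, ∀ z, g (b h z) = σ h (g z) := fun h hh z =>
    (hσ.slot h hh (t, r, z) ⟨ht, PermCode.actionSet_anti e hHK hr⟩).symm
  obtain ⟨a, ha, haσ⟩ := exists_extension_of_embeddings hH hb hf hfσ hg hgb U_meas.compl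
    (fun h hh x hx hx' => hx ((hH.mem_iff hUσ hh).1 hx'))
    (by
      rintro z (hz | ⟨s, hs, hsz⟩)
      · exact Set.disjoint_left.1 X₀_disj hz ⟨_, rfl⟩
      · have := hι.injective hsz
        subst this
        exact hs.1 (Set.mem_insert t C))
  refine ⟨_, ⟨(Set.union_compl_self (X₀ ∪ ι '' T)) ▸ hU.glue ha U_meas disjoint_compl_right,
    ?_, ?_⟩, ?_⟩
  · intro k _
    filter_upwards [X₀_ae, F_ae k] with x hx hk
    rw [if_pos (Set.mem_union_left _ hx), if_pos hx, hk]
  · intro k _ s hs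
    have hs' : ι s ∈ ι '' T := ⟨s, hs, rfl⟩
    rw [if_pos (Set.mem_union_right _ hs'), if_neg (Set.disjoint_right.1 X₀_disj' hs'), hκι]
  · intro h hh
    funext x
    by_cases hxU : x ∈ X₀ ∪ ι '' T
    · rw [if_pos hxU]
      by_cases hx : x ∈ X₀
      · rw [if_pos hx, F_of_mem h hh]
      · obtain ⟨s, hs, rfl⟩ := hxU.resolve_left hx
        rw [if_neg hx, hκι, hσ.slot h hh s (T_sub hs)]
    · rw [if_neg hxU, haσ h hh x hxU]

end Extension

/-! ### Transfinite construction by Zorn's lemma -/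

section Induction

variable {G X : Type*} [Group G] [MeasurableSpace X] {μ : Measure X}
  {η : G → X → X} {e : G → X} {ι : Slot X → X}

/-- A partial model on the subgroup generated by an initial segment of `G`. -/
structure Stage (r : G → G → Prop) (μ : Measure X) (η : G → X → X) (e : G → X)
    (ι : Slot X → X) where
  dom : Set G
  toFun : G → X → X
  lower : ∀ g ∈ dom, ∀ h, r h g → h ∈ dom
  isPartialModel : IsPartialModel μ η e ι (Subgroup.closure dom) (e '' dom) toFun

namespace Stage

variable {r : G → G → Prop}

/-- `q` extends `p`. -/
def Extends (p q : Stage r μ η e ι) : Prop :=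
  p.dom ⊆ q.dom ∧ ∀ g ∈ Subgroup.closure p.dom, q.toFun g = p.toFun g

theorem Extends.trans {p q s : Stage r μ η e ι} (h₁ : p.Extends q) (h₂ : q.Extends s) :
    p.Extends s :=
  ⟨h₁.1.trans h₂.1, fun g hg =>
    (h₂.2 g (Subgroup.closure_mono h₁.1 hg)).trans (h₁.2 g hg)⟩

theorem nonempty [StandardBorelSpace X] (hη : IsNearAction μ η) :
    Nonempty (Stage r μ η e ι) := by
  refine ⟨⟨∅, fun _ x => x, by simp, ⟨⟨fun _ _ => measurable_id, fun _ _ _ _ => trivial,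
    fun _ _ => rfl, fun _ _ _ _ _ _ => rfl⟩, ?_, ?_⟩⟩⟩
  · intro h hh
    rw [Subgroup.closure_empty, Subgroup.mem_bot] at hh
    exact hh ▸ hη.one_ae
  · intro h hh s hs
    rw [Subgroup.closure_empty, Subgroup.mem_bot] at hh
    rw [hh,
      (Slot.isBorelActionOn_actionSet e _ _).one s hs]

open Classical in
theorem exists_extends_of_isChain (c : Set (Stage r μ η e ι)) (hc : IsChain Extends c)
    (hne : c.Nonempty) : ∃ q, ∀ p ∈ c, p.Extends q := by
  have total : ∀ p ∈ c, ∀ q ∈ c, p.Extends q ∨ q.Extends p := by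
    intro p hp q hq
    by_cases h : p = q
    · exact Or.inl (h ▸ ⟨subset_rfl, fun _ _ => rfl⟩)
    · exact hc hp hq h
  set I : Set G := ⋃ p ∈ c, p.dom
  have dom_sub : ∀ p ∈ c, p.dom ⊆ I := fun p hp => Set.subset_biUnion_of_mem hp
  have mem_common : ∀ g h : G, (∃ p ∈ c, g ∈ Subgroup.closure p.dom) →
      (∃ p ∈ c, h ∈ Subgroup.closure p.dom) →
      ∃ p ∈ c, g ∈ Subgroup.closure p.dom ∧ h ∈ Subgroup.closure p.dom := by
    rintro g h ⟨p, hp, hg⟩ ⟨q, hq, hh⟩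
    rcases total p hp q hq with hpq | hpq
    · exact ⟨q, hq, Subgroup.closure_mono hpq.1 hg, hh⟩
    · exact ⟨p, hp, hg, Subgroup.closure_mono hpq.1 hh⟩
  have mem_closure : ∀ g ∈ Subgroup.closure I, ∃ p ∈ c, g ∈ Subgroup.closure p.dom := by
    intro g hg
    induction hg using Subgroup.closure_induction with
    | mem x hx =>
      obtain ⟨p, hp, hxp⟩ := Set.mem_iUnion₂.1 hx
      exact ⟨p, hp, Subgroup.subset_closure hxp⟩
    | one => exact ⟨hne.some, hne.some_mem, one_mem _⟩
    | mul x y _ _ hx hy =>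
      obtain ⟨p, hp, h₁, h₂⟩ := mem_common x y hx hy
      exact ⟨p, hp, mul_mem h₁ h₂⟩
    | inv x _ hx =>
      obtain ⟨p, hp, h⟩ := hx
      exact ⟨p, hp, inv_mem h⟩
  -- The members of the chain agree on common domains, so the choice of member is immaterial.
  let τ : G → X → X := fun g =>
    if h : ∃ p ∈ c, g ∈ Subgroup.closure p.dom then h.choose.toFun g else id
  have τ_eq : ∀ p ∈ c, ∀ g ∈ Subgroup.closure p.dom, τ g = p.toFun g := by
    intro p hp g hg
    have h : ∃ p ∈ c, g ∈ Subgroup.closure p.dom := ⟨p, hp, hg⟩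
    simp only [τ, dif_pos h]
    rcases total p hp _ h.choose_spec.1 with hpq | hpq
    · exact hpq.2 g hg
    · exact (hpq.2 g h.choose_spec.2).symm
  refine ⟨⟨I, τ, ?_, ⟨⟨?_, fun _ _ _ _ => trivial, ?_, ?_⟩, ?_, ?_⟩⟩,
    fun p hp => ⟨dom_sub p hp, τ_eq p hp⟩⟩
  · intro g hg h hhg
    obtain ⟨p, hp, hgp⟩ := Set.mem_iUnion₂.1 hg
    exact dom_sub p hp (p.lower g hgp h hhg)
  · intro g hg
    obtain ⟨p, hp, hgp⟩ := mem_closure g hg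
    rw [τ_eq p hp g hgp]
    exact p.isPartialModel.action.measurable g hgp
  · intro x hx
    rw [τ_eq _ hne.some_mem 1 (one_mem _)]
    exact hne.some.isPartialModel.action.one x hx
  · intro g hg h hh x hx
    obtain ⟨p, hp, hgp, hhp⟩ := mem_common g h (mem_closure g hg) (mem_closure h hh)
    rw [τ_eq p hp g hgp, τ_eq p hp h hhp, τ_eq p hp _ (mul_mem hgp hhp)]
    exact p.isPartialModel.action.mul g hgp h hhp x hx
  · intro g hg
    obtain ⟨p, hp, hgp⟩ := mem_closure g hg
    rw [τ_eq p hp g hgp]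
    exact p.isPartialModel.ae_eq g hgp
  · intro g hg s hs
    obtain ⟨p, hp, hgp⟩ := mem_closure g hg
    rw [τ_eq p hp g hgp]
    exact p.isPartialModel.slot g hgp s (Slot.actionSet_anti e
      (Subgroup.closure_mono (dom_sub p hp)) (Set.image_mono (dom_sub p hp)) hs)

end Stage

theorem Subgroup.countable_closure_of_countable {G : Type*} [Group G] {s : Set G}
    (hs : s.Countable) : Countable (Subgroup.closure s) := by
  have := hs.to_subtype
  rw [FreeGroup.closure_eq_range]
  exact Set.countable_range (FreeGroup.lift ((↑) : s → G))

/-- A maximal stage is defined everywhere: otherwise the least missing `g` has countably many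
predecessors, and the extension step applies with the fresh slot index `e g`. -/
theorem exists_isSpatialModel_of_slot_embedding [StandardBorelSpace X] [Nonempty X]
    (hG : Cardinal.mk G ≤ Cardinal.aleph 1) (hη : IsNearAction μ η)
    (he : Function.Injective e) (hι : MeasurableEmbedding ι) (hιμ : μ (Set.range ι) = 0) :
    ∃ ρ : G → X → X, IsSpatialModel μ η ρ ∧ ActsByBorelAutomorphisms ρ := by
  obtain ⟨r, hr, hord⟩ := Cardinal.exists_ord_eq G
  have initial_countable : ∀ g, {h | r h g}.Countable := by
    intro g
    have h := (Cardinal.card_typein_lt g hord).trans_le hG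
    rw [← Cardinal.le_aleph0_iff_set_countable, ← Order.lt_succ_iff, Cardinal.succ_aleph0]
    exact h
  have : Nonempty (Stage r μ η e ι) := Stage.nonempty hη
  obtain ⟨p, hp⟩ := exists_maximal_of_nonempty_chains_bounded
    (r := Stage.Extends (r := r) (μ := μ) (η := η) (e := e) (ι := ι))
    Stage.exists_extends_of_isChain Stage.Extends.trans
  have dom_univ : p.dom = Set.univ := by
    by_contra hne
    obtain ⟨g₀, hg₀⟩ := (Set.ne_univ_iff_exists_notMem _).1 hne
    obtain ⟨g, hg, hmin⟩ := hr.wf.has_min (p.domᶜ) ⟨g₀, hg₀⟩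
    have lt_iff : ∀ h ∈ p.dom, r h g := by
      intro h hh
      rcases trichotomous_of r h g with h' | h' | h'
      · exact h'
      · exact absurd (h' ▸ hh) hg
      · exact absurd (p.lower h hh g h') hg
    have dom_countable : p.dom.Countable := (initial_countable g).mono lt_iff
    have := Subgroup.countable_closure_of_countable (dom_countable.insert g)
    have het : e g ∉ e '' p.dom := fun h => hg ((he.mem_set_image).1 h)
    obtain ⟨σ, hσ, hσp⟩ := p.isPartialModel.exists_extension hη he hι hιμ
      (Subgroup.closure_mono (Set.subset_insert g p.dom)) (dom_countable.image e) het
    rw [← Set.image_insert_eq] at hσ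
    let q : Stage r μ η e ι := ⟨insert g p.dom, σ, by
      rintro h (rfl | hh) k hk
      · by_contra hk'
        exact hmin k (fun hkp => hk' (Or.inr hkp)) hk
      · exact Or.inr (p.lower h hh k hk), hσ⟩
    exact hg ((hp q ⟨Set.subset_insert g p.dom, hσp⟩).1 (Set.mem_insert g p.dom))
  have hpm := p.isPartialModel
  rw [dom_univ, Subgroup.closure_univ] at hpm
  exact ⟨p.toFun, isSpatialModel_of_isBorelActionOn hη hpm.action fun g => hpm.ae_eq g trivial⟩

end Induction

/-- The measurable hull of `N` is an uncountable Borel null set, hence Borel isomorphic to the space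
of slots. Since `X` has the cardinality of the continuum, `G` injects into it, which supplies names
for codes and slot indices. -/
theorem exists_isSpatialModel_of_mk_le_aleph_one {G : Type v} {X : Type u} [Group G]
    [MeasurableSpace X] [StandardBorelSpace X] {μ : Measure X} {N : Set X} (hN : ¬ N.Countable)
    (hμN : μ N = 0) (hG : Cardinal.mk G ≤ Cardinal.aleph 1) {η : G → X → X}
    (hη : IsNearAction μ η) :
    ∃ ρ : G → X → X, IsSpatialModel μ η ρ ∧ ActsByBorelAutomorphisms ρ := by
  have hM := measurableSet_toMeasurable μ N
  have hMc : ¬ (toMeasurable μ N).Countable := fun h => hN (h.mono (subset_toMeasurable μ N))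
  have hX : ¬ Countable X := fun h => hMc (Set.to_countable _)
  have : Nonempty X := by
    by_contra h
    rw [not_nonempty_iff] at h
    exact hX inferInstance
  have := hM.standardBorel
  have hS : ¬ Countable (Slot X) := fun h => hX
    (Function.Injective.countable (f := fun x : X => ((x, Classical.arbitrary _) : Slot X))
      fun x y hxy => congrArg Prod.fst hxy)
  let φ := PolishSpace.measurableEquivOfNotCountable hS hMc
  obtain ⟨e⟩ : Nonempty (G ↪ X) := by
    rw [← Cardinal.lift_mk_le']
    have hXc : Cardinal.lift.{v} (Cardinal.mk X) = Cardinal.continuum := by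
      have := Cardinal.lift_mk_eq'.2
        ⟨(PolishSpace.measurableEquivOfNotCountable (β := ℝ) hX not_countable).toEquiv⟩
      rw [Cardinal.mk_real] at this
      simp only [Cardinal.lift_continuum, Cardinal.lift_id'] at this
      rw [this, Cardinal.lift_continuum]
    rw [hXc]
    calc Cardinal.lift.{u} (Cardinal.mk G) ≤ Cardinal.lift.{u} (Cardinal.aleph 1) :=
          Cardinal.lift_le.2 hG
      _ = Cardinal.aleph 1 := by simp
      _ ≤ Cardinal.continuum := Cardinal.aleph_one_le_continuum
  refine exists_isSpatialModel_of_slot_embedding (e := e) (ι := Subtype.val ∘ φ) hG hη e.injective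
    ((MeasurableEmbedding.subtype_coe hM).comp φ.measurableEmbedding) ?_
  refine measure_mono_null ?_ ((measure_toMeasurable N).trans hμN)
  rintro _ ⟨s, rfl⟩
  exact (φ s).2

/-! ### Quotient by the kernel and the Continuum Hypothesis -/

namespace IsNearAction

variable {G X : Type*} [Group G] [MeasurableSpace X] {μ : Measure X} {η : G → X → X}

/-- The elements of `G` that act trivially almost everywhere. -/
def kernel (hη : IsNearAction μ η) : Subgroup G where
  carrier := {g | ∀ᵐ x ∂μ, η g x = x}
  one_mem' := hη.one_ae
  mul_mem' {g h} hg hh := by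
    change ∀ᵐ x ∂μ, η (g * h) x = x
    filter_upwards [hη.mul_ae g h, hg, hh] with x h₁ h₂ h₃
    rw [h₁, h₃, h₂]
  inv_mem' {g} hg := by
    change ∀ᵐ x ∂μ, η g⁻¹ x = x
    filter_upwards [hη.inv_apply_ae g, hg] with x h₁ h₂
    rwa [h₂] at h₁

theorem mem_kernel (hη : IsNearAction μ η) {g : G} : g ∈ hη.kernel ↔ ∀ᵐ x ∂μ, η g x = x :=
  Iff.rfl

instance kernel_normal (hη : IsNearAction μ η) : hη.kernel.Normal where
  conj_mem n hn g := by
    rw [mem_kernel]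
    have h := hη.inv_apply_ae g⁻¹
    rw [inv_inv] at h
    filter_upwards [hη.mul_ae (g * n) g⁻¹, hη.ae_comp g⁻¹ (hη.mul_ae g n),
      hη.ae_comp g⁻¹ (hη.mem_kernel.1 hn), h] with x h₁ h₂ h₃ h₄
    rw [h₁, h₂, h₃, h₄]

theorem mk_eq_mk_iff (hη : IsNearAction μ η) {g h : G} :
    (QuotientGroup.mk g : G ⧸ hη.kernel) = QuotientGroup.mk h ↔ ∀ᵐ x ∂μ, η g x = η h x := by
  rw [QuotientGroup.eq, mem_kernel]
  constructor
  · intro hgh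
    filter_upwards [hη.mul_ae g (g⁻¹ * h), hgh] with x h₁ h₂
    rw [mul_inv_cancel_left, h₂] at h₁
    exact h₁.symm
  · intro hgh
    filter_upwards [hη.mul_ae g⁻¹ h, hgh, hη.inv_apply_ae g] with x h₁ h₂ h₃
    rw [h₁, ← h₂, h₃]

theorem out_mk_ae (hη : IsNearAction μ η) (g : G) :
    ∀ᵐ x ∂μ, η (QuotientGroup.mk g : G ⧸ hη.kernel).out x = η g x :=
  hη.mk_eq_mk_iff.1 (QuotientGroup.out_eq' _)

/-- The near-action induced by `η` on the quotient by its kernel. -/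
theorem quotient (hη : IsNearAction μ η) :
    IsNearAction μ fun q : G ⧸ hη.kernel => η q.out where
  one_ae := by
    filter_upwards [hη.out_mk_ae 1, hη.one_ae] with x h₁ h₂
    exact h₁.trans h₂
  mul_ae p q := by
    have : (QuotientGroup.mk (p.out * q.out) : G ⧸ hη.kernel) = p * q := by
      rw [QuotientGroup.mk_mul, QuotientGroup.out_eq', QuotientGroup.out_eq']
    have h := hη.out_mk_ae (p.out * q.out)
    rw [this] at h
    filter_upwards [h, hη.mul_ae p.out q.out] with x h₁ h₂
    rw [h₁, h₂]
  preserves q := hη.preserves q.out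

end IsNearAction

/-- A coset is determined by a Borel representative, and that by the preimages of a countable
separating family. There are at most continuum many Borel sets, hence at most continuum many
sequences of them. -/
theorem IsNearAction.lift_mk_quotient_kernel_le {G : Type v} {X : Type u} [Group G]
    [MeasurableSpace X] [StandardBorelSpace X] {μ : Measure X} {η : G → X → X}
    (hη : IsNearAction μ η) :
    Cardinal.lift.{u} (Cardinal.mk (G ⧸ hη.kernel)) ≤ Cardinal.continuum := by
  obtain ⟨φ, hφ, hφi⟩ := MeasurableSpace.measurable_injection_nat_bool_of_countablySeparated X
  let F : G ⧸ hη.kernel → X → X := fun q => (hη.aemeasurable q.out).mk (η q.out)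
  have F_meas : ∀ q, Measurable (F q) := fun q => (hη.aemeasurable q.out).measurable_mk
  have F_ae : ∀ q, ∀ᵐ x ∂μ, η (Quotient.out q) x = F q x := fun q =>
    (hη.aemeasurable q.out).ae_eq_mk
  let Φ : G ⧸ hη.kernel → ℕ → {s : Set X // MeasurableSet s} := fun q n =>
    ⟨{x | φ (F q x) n = true}, (((measurable_pi_apply n).comp hφ).comp (F_meas q))
      (measurableSet_singleton true)⟩
  have Φ_inj : Function.Injective Φ := by
    intro p q hpq
    have hF : F p = F q := by
      funext x
      refine hφi (funext fun n => ?_)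
      have : x ∈ (Φ p n).1 ↔ x ∈ (Φ q n).1 := by rw [hpq]
      exact Bool.eq_iff_iff.2 this
    rw [← QuotientGroup.out_eq' p, ← QuotientGroup.out_eq' q, hη.mk_eq_mk_iff]
    filter_upwards [F_ae p, F_ae q] with x h₁ h₂
    rw [h₁, h₂, hF]
  have hM : Cardinal.mk {s : Set X // MeasurableSet s} ≤ Cardinal.continuum := by
    obtain ⟨b, hb, hgen⟩ := MeasurableSpace.CountablyGenerated.isCountablyGenerated (α := X)
    have := MeasurableSpace.cardinal_measurableSet_le_continuum (s := b)
      ((Cardinal.le_aleph0_iff_set_countable.2 hb).trans Cardinal.aleph0_le_continuum)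
    rwa [← hgen] at this
  calc Cardinal.lift.{u} (Cardinal.mk (G ⧸ hη.kernel))
      ≤ Cardinal.lift.{v} (Cardinal.mk (ℕ → {s : Set X // MeasurableSet s})) :=
        Cardinal.lift_mk_le'.2 ⟨⟨Φ, Φ_inj⟩⟩
    _ ≤ Cardinal.lift.{v} Cardinal.continuum := by
        refine Cardinal.lift_le.2 ?_
        rw [Cardinal.mk_arrow, Cardinal.mk_nat, Cardinal.lift_aleph0, Cardinal.lift_uzero,
          ← Cardinal.continuum_power_aleph0]
        exact Cardinal.power_le_power_right hM
    _ = Cardinal.continuum := by simp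

theorem exists_isSpatialModel_of_continuum_eq_aleph_one {G : Type v} {X : Type u} [Group G]
    [MeasurableSpace X] [StandardBorelSpace X] {μ : Measure X} {N : Set X} (hN : ¬ N.Countable)
    (hμN : μ N = 0) (hCH : Cardinal.continuum.{0} = Cardinal.aleph 1) {η : G → X → X}
    (hη : IsNearAction μ η) :
    ∃ ρ : G → X → X, IsSpatialModel μ η ρ ∧ ActsByBorelAutomorphisms ρ := by
  have hQ : Cardinal.mk (G ⧸ hη.kernel) ≤ Cardinal.aleph 1 := by
    rw [← Cardinal.lift_le.{u}]
    refine hη.lift_mk_quotient_kernel_le.trans (le_of_eq ?_)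
    have := congrArg Cardinal.lift.{max u v} hCH
    simpa using this
  obtain ⟨ρ, hρ, hρ'⟩ := exists_isSpatialModel_of_mk_le_aleph_one hN hμN hQ hη.quotient
  refine ⟨fun g => ρ (QuotientGroup.mk g), ⟨⟨hρ.isSpatialAction.one, fun g h x => ?_,
    fun g => hρ.isSpatialAction.preserves _⟩, fun g => ?_⟩, fun g => hρ' _⟩
  · exact hρ.isSpatialAction.mul (QuotientGroup.mk g) (QuotientGroup.mk h) x
  · filter_upwards [hη.out_mk_ae g, hρ.ae_eq (QuotientGroup.mk g)] with x h₁ h₂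
    rw [← h₁, h₂]

/-! ### Uncountable null sets of σ-finite measures -/

/-- Identify `X` with `ℝ × ℝ`. The vertical lines are uncountably many disjoint uncountable Borel
sets, and σ-finiteness lets only countably many have positive measure. -/
theorem exists_uncountable_null_set {X : Type*} [MeasurableSpace X] [StandardBorelSpace X]
    [Uncountable X] (μ : Measure X) [SigmaFinite μ] :
    ∃ N : Set X, MeasurableSet N ∧ ¬ N.Countable ∧ μ N = 0 := by
  have hX : ¬ Countable X := not_countable
  have hR : ¬ Countable (ℝ × ℝ) := not_countable
  let φ := PolishSpace.measurableEquivOfNotCountable hX hR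
  let A : ℝ → Set X := fun r => {x | (φ x).1 = r}
  have hA : ∀ r, MeasurableSet (A r) := fun r =>
    measurableSet_eq_fun (measurable_fst.comp φ.measurable) measurable_const
  have hdisj : Pairwise (Function.onFun Disjoint A) := fun r s hrs =>
    Set.disjoint_left.2 fun x hx hx' => hrs (Eq.trans (Eq.symm hx) hx')
  have hc := Measure.countable_meas_pos_of_disjoint_iUnion (μ := μ) hA hdisj
  obtain ⟨r, hr⟩ : ∃ r, r ∉ {r | 0 < μ (A r)} := by
    by_contra! h
    exact Set.not_countable_univ (hc.mono fun r _ => h r)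
  refine ⟨A r, hA r, fun h => ?_, by simpa using hr⟩
  refine Set.not_countable_univ (α := ℝ) ((h.preimage_of_injOn (f := fun s => φ.symm (r, s))
    (fun s _ t _ hst => ?_)).mono fun s _ => ?_)
  · simpa using hst
  · change (φ (φ.symm (r, s))).1 = r
    simp

theorem mainTheorem4 {X : Type u} [MeasurableSpace X] [StandardBorelSpace X]
    (μ : Measure X) :
    (Uncountable X → SigmaFinite μ →
      ∃ N : Set X, MeasurableSet N ∧ ¬ N.Countable ∧ μ N = 0) ∧
    ((∃ N : Set X, ¬ N.Countable ∧ μ N = 0) →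
      (∀ (G : Type v) [Group G], Cardinal.mk G ≤ Cardinal.aleph 1 →
        ∀ η : G → X → X, IsNearAction μ η →
          ∃ ρ : G → X → X, IsSpatialModel μ η ρ ∧ ActsByBorelAutomorphisms ρ) ∧
      (Cardinal.continuum.{0} = Cardinal.aleph 1 →
        ∀ (G : Type v) [Group G],
        ∀ η : G → X → X, IsNearAction μ η →
          ∃ ρ : G → X → X, IsSpatialModel μ η ρ ∧ ActsByBorelAutomorphisms ρ)) := by
  refine ⟨fun _ _ => exists_uncountable_null_set μ, ?_⟩
  rintro ⟨N, hN, hμN⟩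
  exact ⟨fun G _ hG η hη => exists_isSpatialModel_of_mk_le_aleph_one hN hμN hG hη,
    fun hCH G _ η hη => exists_isSpatialModel_of_continuum_eq_aleph_one hN hμN hCH hη⟩
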